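/- An interval exchange transformation (IET) of $[0,1)$ is a bijection $T:[0,1)\to[0,1)$ for which there are $n\ge 1$, lengths $l_1,\dots,l_n>0$ with $\sum_i l_i=1$ and a permutation $\sigma\in\mathfrak S_n$ such that, for each $i$, $T$ translates the interval $\big[\sum_{j<i}l_j,\ \sum_{j\le i}l_j\big)$ by $\sum_{\sigma(j)<\sigma(i)}l_j-\sum_{j<i}l_j$. Taking the intervals to be the maximal intervals of continuity, i.e. requiring $\sigma(i+1)\ne\sigma(i)+1$ for $1\le i<n$, makes $\lambda(T)=(l_1,\dots,l_n)$ and $\pi(T)=\sigma$ unique. The set of IETs carries the topology of the extended distance $d(S,T)=\|\lambda(S)-\lambda(T)\|_1$ if $\pi(S)=\pi(T)$, and $d(S,T)=\infty$ otherwise. An IET $T$ with $\pi(T)=\sigma\in\mathfrak S_n$ is admissible if there is no $k\in\{1,\dots,n\}$ with $\sigma(k)=k$ and $\sigma(\{1,\dots,k\})=\{1,\dots,k\}$; let $\mathrm{IET}_a([0,1))$ be the set of admissible IETs with the subspace topology. **Theorem.** Let $S$ be any IET of $[0,1)$. There exists a dense open subset $\Omega_a(S)$ of $\mathrm{IET}_a([0,1))$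 such that for every $T\in\Omega_a(S)$ the group $\langle S,T\rangle$ generated by $S$ and $T$ (under composition) is not a free group of rank $2$. -/

import Mathlib

/-- An interval exchange transformation of `[0,1)`: a bijection `toPerm` of `[0,1)` which, for
lengths `len 0, …, len (n-1) > 0` of total length `1` and a permutation `perm`, cuts `[0,1)` into
consecutive half-open intervals with these lengths and moves the `i`-th one by a translation, so
that it becomes the `perm i`-th interval from the left.

The condition `reduced` says that adjacent intervals do not stay adjacent in the same order, so that
the intervals are exactly the maximal intervals of continuity. Hence `n`, `perm` and `len` are
determined by the transformation, see `IET.toPerm_injective`. -/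
structure IET where
  /-- the transformation of `[0,1)` -/
  toPerm : Equiv.Perm (Set.Ico (0 : ℝ) 1)
  /-- the number of intervals of continuity -/
  n : ℕ
  /-- the underlying permutation -/
  perm : Equiv.Perm (Fin n)
  /-- the lengths of the intervals of continuity, from left to right -/
  len : Fin n → ℝ
  len_pos : ∀ i, 0 < len i
  len_sum : ∑ i, len i = 1
  reduced : ∀ i j : Fin n, (j : ℕ) = i + 1 → (perm j : ℕ) ≠ perm i + 1
  toPerm_apply : ∀ (i : Fin n) (x : Set.Ico (0 : ℝ) 1),
    (∑ j with j < i, len j) ≤ (x : ℝ) → (x : ℝ) < (∑ j with j < i, len j) + len i →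
      (toPerm x : ℝ) = x + ((∑ j with perm j < perm i, len j) - (∑ j with j < i, len j))

namespace IET

/-- Two IETs have the same underlying permutation (in particular, the same number of intervals). -/
def SamePerm (S T : IET) : Prop :=
  ∃ h : S.n = T.n, ∀ i, Fin.cast h (S.perm i) = T.perm (Fin.cast h i)

open Classical in
/-- The extended distance on IETs: the `ℓ¹` distance of the length vectors if the underlying
permutations agree, and `∞` otherwise. -/
noncomputable instance : EDist IET where
  edist S T :=
    if h : SamePerm S T then ENNReal.ofReal (∑ i, |S.len i - T.len (Fin.cast h.fst i)|) else ⊤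

theorem edist_def (S T : IET) (h : SamePerm S T) :
    edist S T = ENNReal.ofReal (∑ i, |S.len i - T.len (Fin.cast h.fst i)|) := dif_pos h

theorem edist_eq_top (S T : IET) (h : ¬ SamePerm S T) : edist S T = ⊤ := dif_neg h

theorem SamePerm.symm {S T : IET} (h : SamePerm S T) : SamePerm T S := by
  obtain ⟨_, n, σ, l, _, _, _, _⟩ := S
  obtain ⟨_, m, τ, l', _, _, _, _⟩ := T
  obtain ⟨h, h'⟩ := h
  dsimp only at h h'
  subst h
  exact ⟨rfl, fun i => (h' i).symm⟩

theorem SamePerm.trans {S T U : IET} (h : SamePerm S T) (k : SamePerm T U) : SamePerm S U := by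
  obtain ⟨_, n, σ, l, _, _, _, _⟩ := S
  obtain ⟨_, m, τ, l', _, _, _, _⟩ := T
  obtain ⟨_, p, υ, l'', _, _, _, _⟩ := U
  obtain ⟨h, h'⟩ := h
  obtain ⟨k, k'⟩ := k
  dsimp only at h h' k k'
  subst h k
  exact ⟨rfl, fun i => (h' i).trans (k' i)⟩

theorem edist_le_of_samePerm (S T : IET) (h : SamePerm S T) : edist S T ≤ edist T S := by
  rw [edist_def S T h, edist_def T S h.symm]
  obtain ⟨_, n, σ, l, _, _, _, _⟩ := S
  obtain ⟨_, m, τ, l', _, _, _, _⟩ := T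
  obtain ⟨h, h'⟩ := h
  dsimp only at h h'
  subst h
  refine ENNReal.ofReal_le_ofReal (Finset.sum_le_sum fun i _ => ?_)
  exact (abs_sub_comm _ _).le

theorem edist_triangle_of_samePerm (S T U : IET) (h : SamePerm S T) (k : SamePerm T U) :
    edist S U ≤ edist S T + edist T U := by
  rw [edist_def S T h, edist_def T U k, edist_def S U (h.trans k),
    ← ENNReal.ofReal_add (by positivity) (by positivity)]
  obtain ⟨_, n, σ, l, _, _, _, _⟩ := S
  obtain ⟨_, m, τ, l', _, _, _, _⟩ := T
  obtain ⟨_, p, υ, l'', _, _, _, _⟩ := U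
  obtain ⟨h, h'⟩ := h
  obtain ⟨k, k'⟩ := k
  dsimp only at h h' k k'
  subst h k
  refine ENNReal.ofReal_le_ofReal ?_
  rw [← Finset.sum_add_distrib]
  exact Finset.sum_le_sum fun i _ => abs_sub_le _ _ _

/-- The topology on IETs is the one of the extended distance above. -/
noncomputable instance : PseudoEMetricSpace IET where
  edist_self S := by
    rw [edist_def S S ⟨rfl, fun _ => rfl⟩]
    simp
  edist_comm S T := by
    by_cases h : SamePerm S T
    · exact le_antisymm (edist_le_of_samePerm S T h) (edist_le_of_samePerm T S h.symm)
    · rw [edist_eq_top S T h, edist_eq_top T S fun k => h k.symm]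
  edist_triangle S T U := by
    by_cases h : SamePerm S T
    · by_cases k : SamePerm T U
      · exact edist_triangle_of_samePerm S T U h k
      · simp [edist_eq_top T U k]
    · simp [edist_eq_top S T h]

/-- An IET is admissible when there is no `k` which is fixed by its underlying permutation and for
which the initial segment ending at `k` is invariant. -/
def IsAdmissible (T : IET) : Prop :=
  ¬ ∃ k : Fin T.n, T.perm k = k ∧ T.perm '' Set.Iic k = Set.Iic k

theorem sum_lt_add_le (T : IET) (i : Fin T.n) : ∑ j with j < i, T.len j + T.len i ≤ 1 := by
  rw [← T.len_sum, add_comm, ← Finset.sum_insert (by simp)]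
  exact Finset.sum_le_sum_of_subset_of_nonneg (Finset.subset_univ _) fun j _ _ => (T.len_pos j).le

theorem sum_lt_nonneg (T : IET) (i : Fin T.n) : 0 ≤ ∑ j with j < i, T.len j :=
  Finset.sum_nonneg fun j _ => (T.len_pos j).le

theorem sum_lt_succ (T : IET) (i j : Fin T.n) (h : (j : ℕ) = i + 1) :
    ∑ k with k < j, T.len k = ∑ k with k < i, T.len k + T.len i := by
  rw [add_comm, ← Finset.sum_insert (by simp)]
  congr 1
  ext k
  simp only [Finset.mem_filter, Finset.mem_insert, Finset.mem_univ, true_and, Fin.lt_def,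
    Fin.ext_iff]
  omega

/-- Adjacent intervals have different translation lengths. -/
theorem translation_ne (T : IET) (i j : Fin T.n) (h : (j : ℕ) = i + 1) :
    ∑ k with T.perm k < T.perm j, T.len k - ∑ k with k < j, T.len k ≠
      ∑ k with T.perm k < T.perm i, T.len k - ∑ k with k < i, T.len k := by
  rw [T.sum_lt_succ i j h]
  intro e
  have e' : ∑ k with T.perm k < T.perm j, T.len k =
      ∑ k with T.perm k < T.perm i, T.len k + T.len i := by linarith
  have hi := T.len_pos i
  rcases lt_or_ge (T.perm i) (T.perm j) with hlt | hle
  · obtain ⟨m, hm⟩ := T.perm.surjective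
      (⟨T.perm i + 1, lt_of_le_of_lt (Nat.succ_le_of_lt hlt) (T.perm j).2⟩ : Fin T.n)
    have hm' : (T.perm m : ℕ) = T.perm i + 1 := by rw [hm]
    have hne := T.reduced i j h
    have hmj : T.perm m < T.perm j := by
      rw [Fin.lt_def] at hlt ⊢
      omega
    have hsub : insert m (insert i (Finset.univ.filter fun k => T.perm k < T.perm i)) ⊆
        Finset.univ.filter fun k => T.perm k < T.perm j := by
      intro k hk
      simp only [Finset.mem_insert, Finset.mem_filter, Finset.mem_univ, true_and] at hk ⊢
      rcases hk with rfl | rfl | hk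
      · exact hmj
      · exact hlt
      · exact hk.trans hlt
    have hle := Finset.sum_le_sum_of_subset_of_nonneg hsub fun k _ _ => (T.len_pos k).le
    rw [Finset.sum_insert, Finset.sum_insert (by simp)] at hle
    · have := T.len_pos m
      linarith
    · simp only [Finset.mem_insert, Finset.mem_filter, Finset.mem_univ, true_and, not_or]
      refine ⟨fun e => ?_, fun e => ?_⟩
      · rw [e] at hm'
        omega
      · rw [Fin.lt_def] at e
        omega
  · have hle' : ∑ k with T.perm k < T.perm j, T.len k ≤ ∑ k with T.perm k < T.perm i, T.len k := by
      refine Finset.sum_le_sum_of_subset_of_nonneg (fun k hk => ?_) fun k _ _ => (T.len_pos k).le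
      simp only [Finset.mem_filter, Finset.mem_univ, true_and] at hk ⊢
      exact hk.trans_le hle
    linarith

/-- The left end point of the `i`-th interval, as a point of `[0,1)`. -/
noncomputable def leftPt (T : IET) (i : Fin T.n) : Set.Ico (0 : ℝ) 1 :=
  ⟨∑ j with j < i, T.len j, T.sum_lt_nonneg i,
    by have := T.sum_lt_add_le i; have := T.len_pos i; linarith⟩

theorem toPerm_leftPt (T : IET) (i : Fin T.n) :
    (T.toPerm (T.leftPt i) : ℝ) = ∑ j with T.perm j < T.perm i, T.len j := by
  rw [T.toPerm_apply i _ le_rfl (by simpa [leftPt] using T.len_pos i)]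
  simp [leftPt]

theorem exists_succ_of_lt_one (T : IET) (i : Fin T.n)
    (h : ∑ j with j < i, T.len j + T.len i < 1) : (i : ℕ) + 1 < T.n := by
  by_contra hn
  have : insert i (Finset.univ.filter fun j => j < i) = Finset.univ := by
    ext k
    simp only [Finset.mem_filter, Finset.mem_insert, Finset.mem_univ, true_and, Fin.lt_def,
      Fin.ext_iff, iff_true]
    omega
  rw [add_comm, ← Finset.sum_insert (by simp), this, T.len_sum] at h
  exact lt_irrefl _ h

theorem len_le_of_toPerm_eq (S T : IET) (h : S.toPerm = T.toPerm) (i : Fin S.n) (j : Fin T.n)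
    (hij : ∑ k with k < i, S.len k = ∑ k with k < j, T.len k) : T.len j ≤ S.len i := by
  by_contra! hlt
  have hS := T.sum_lt_add_le j
  have hi := S.exists_succ_of_lt_one i (by linarith)
  have hs := S.sum_lt_succ i ⟨i + 1, hi⟩ rfl
  apply S.translation_ne i ⟨i + 1, hi⟩ rfl
  have e : S.leftPt i = T.leftPt j := Subtype.ext hij
  have h1 := S.toPerm_leftPt ⟨i + 1, hi⟩
  have h2 := S.toPerm_leftPt i
  have h3 := T.toPerm_leftPt j
  have h4 := T.toPerm_apply j (S.leftPt ⟨i + 1, hi⟩)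
    (by have := S.len_pos i; simp only [leftPt]; linarith) (by simp only [leftPt]; linarith)
  rw [← h] at h3 h4
  rw [e, h3] at h2
  rw [h1] at h4
  simp only [leftPt] at h4
  rw [h4, ← h2, hij]
  ring

theorem sum_lt_eq_of_toPerm_eq (S T : IET) (h : S.toPerm = T.toPerm) (k : ℕ) (hS : k < S.n)
    (hT : k < T.n) :
    ∑ j with j < (⟨k, hS⟩ : Fin S.n), S.len j = ∑ j with j < (⟨k, hT⟩ : Fin T.n), T.len j := by
  induction k with
  | zero => simp [Fin.lt_def]
  | succ k ih =>
    have ih := ih (by omega) (by omega)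
    rw [S.sum_lt_succ ⟨k, by omega⟩ ⟨k + 1, hS⟩ rfl, T.sum_lt_succ ⟨k, by omega⟩ ⟨k + 1, hT⟩ rfl,
      ih, le_antisymm (len_le_of_toPerm_eq T S h.symm _ _ ih.symm)
        (len_le_of_toPerm_eq S T h _ _ ih)]

theorem n_le_of_toPerm_eq (S T : IET) (h : S.toPerm = T.toPerm) : S.n ≤ T.n := by
  by_contra! hlt
  have hT0 : T.n ≠ 0 := fun h0 => by
    have : IsEmpty (Fin T.n) := by rw [h0]; infer_instance
    have := T.len_sum
    simp at this
  have e := sum_lt_eq_of_toPerm_eq S T h (T.n - 1) (by omega) (by omega)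
  have hle := len_le_of_toPerm_eq S T h _ _ e
  have h1 := S.sum_lt_succ ⟨T.n - 1, by omega⟩ ⟨T.n, hlt⟩ (by simp; omega)
  have h2 := S.sum_lt_add_le ⟨T.n, hlt⟩
  have h3 := S.len_pos ⟨T.n, hlt⟩
  have h4 := T.exists_succ_of_lt_one ⟨T.n - 1, by omega⟩ (by linarith)
  simp at h4
  omega

theorem sum_perm_lt_iff (T : IET) (i j : Fin T.n) :
    ∑ k with T.perm k < T.perm i, T.len k < ∑ k with T.perm k < T.perm j, T.len k ↔
      T.perm i < T.perm j := by
  have key : ∀ i j, T.perm i ≤ T.perm j →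
      ∑ k with T.perm k < T.perm i, T.len k ≤ ∑ k with T.perm k < T.perm j, T.len k := by
    intro i j hij
    refine Finset.sum_le_sum_of_subset_of_nonneg (fun k hk => ?_) fun k _ _ => (T.len_pos k).le
    simp only [Finset.mem_filter, Finset.mem_univ, true_and] at hk ⊢
    exact hk.trans_le hij
  constructor
  · intro h
    by_contra! h'
    exact absurd (key j i h') (not_le.2 h)
  · intro h
    refine Finset.sum_lt_sum_of_subset (i := i) (fun k hk => ?_) (by simpa using h) (by simp)
      (T.len_pos i) fun k _ _ => (T.len_pos k).le
    simp only [Finset.mem_filter, Finset.mem_univ, true_and] at hk ⊢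
    exact hk.trans h

/-- The number of intervals, the permutation and the lengths are determined by the
transformation. -/
theorem toPerm_injective : Function.Injective toPerm := by
  intro S T h
  have hn := le_antisymm (n_le_of_toPerm_eq S T h) (n_le_of_toPerm_eq T S h.symm)
  have hs := sum_lt_eq_of_toPerm_eq S T h
  have hl1 := len_le_of_toPerm_eq S T h
  have hl2 := len_le_of_toPerm_eq T S h.symm
  have hpS := S.toPerm_leftPt
  have hpT := T.toPerm_leftPt
  have hiS := S.sum_perm_lt_iff
  have hiT := T.sum_perm_lt_iff
  have hlp : ∀ (k : ℕ) (hS : k < S.n) (hT : k < T.n), S.leftPt ⟨k, hS⟩ = T.leftPt ⟨k, hT⟩ :=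
    fun k hS hT => Subtype.ext (hs k hS hT)
  have hlt : ∀ (hn : S.n = T.n) (i j : Fin S.n), S.perm i < S.perm j ↔
      T.perm (Fin.cast hn i) < T.perm (Fin.cast hn j) := by
    intro hn i j
    rw [← hiS, ← hiT, ← hpS, ← hpS, ← hpT, ← hpT, h]
    simp only [Fin.cast]
    rw [← hlp _ i.2, ← hlp _ j.2]
  clear hpS hpT hiS hiT hlp
  obtain ⟨f, n, σ, l, _, _, _, _⟩ := S
  obtain ⟨g, m, τ, l', _, _, _, _⟩ := T
  dsimp only at *
  subst h hn
  have hl : l = l' := funext fun i => le_antisymm (hl2 i i (hs i i.2 i.2).symm)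
    (hl1 i i (hs i i.2 i.2))
  subst hl
  have hσ : σ = τ := by
    have hmono : StrictMono (σ.symm.trans τ) := by
      intro a b hab
      have := (hlt rfl (σ.symm a) (σ.symm b)).1 (by simpa using hab)
      simpa using this
    have he : (hmono.orderIsoOfSurjective _ (σ.symm.trans τ).surjective) = OrderIso.refl _ :=
      Subsingleton.elim _ _
    ext i
    have := congrArg (fun e => e (σ i)) he
    simp at this
    rw [this]
  subst hσ
  rfl

end IET

/-- The admissible IETs, with the subspace topology. -/
abbrev AdmissibleIET : Type := {T : IET // T.IsAdmissible}

/-!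
Perturb an admissible `T` with permutation `σ` first to rational lengths `a j / q` and then to
`a j / q + t (j - σ j)` with `t > 0` small. Initial segments have the smallest sums of positions
among sets of the same size, so admissibility makes every translation length in the direction
`j - σ j` positive. Hence every exchange close to the perturbed one moves all points modulo `1 / q`
a little to the right, and it translates the cells `[m / q, (m + 1) / q)`, up to small margins.
Its power `g = T ^ q!` sends each cell back to itself and translates it slightly. Away from the
cell boundaries and the finitely many singularities of `S`, modulo `1 / q`, both `g` and `S⁻¹ g S`
are therefore small translations and commute. So `u = [(S⁻¹ g S)⁻¹, g⁻¹]` is supported in small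
neighbourhoods of finitely many points modulo `1 / q`. A suitable power `T ^ k` drifts these
neighbourhoods off each other, so `u` commutes with `T ^ k u T ^ (-k)`. This relation fails in
`SL(2, ℤ)`, while in a residually finite group every relation between generators of a free group
of rank two is satisfied by all pairs.
-/

section FreeGroup

variable {ι G H : Type*} [Group G] [Group H] {x : ι → G}

/-- In a finite target every tuple is the image of `x`: the `|H| ^ |ι|` homomorphisms from the free
group restrict to different tuples, so by counting they realise all of them. -/
theorem lift_eq_one_of_mulEquiv_of_finite [Finite ι] [Finite H]
    (e : Subgroup.closure (Set.range x) ≃* FreeGroup ι) {w : FreeGroup ι}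
    (hw : FreeGroup.lift x w = 1) (y : ι → H) : FreeGroup.lift y w = 1 := by
  let x' : ι → Subgroup.closure (Set.range x) := fun i => ⟨x i, Subgroup.subset_closure ⟨i, rfl⟩⟩
  have hx' : Subgroup.closure (Set.range x') = ⊤ := by
    rw [← Subgroup.closure_closure_coe_preimage]
    congr 1
    ext z
    simp [x', Subtype.ext_iff]
  have hinj : Function.Injective fun (f : ι → H) i => FreeGroup.lift f (e (x' i)) := by
    intro f f' hff'
    have hcomp : (FreeGroup.lift f).comp e.toMonoidHom = (FreeGroup.lift f').comp e.toMonoidHom :=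
      MonoidHom.eq_of_eqOn_dense hx' (Set.forall_mem_range.2 (congrFun hff'))
    refine FreeGroup.lift.injective (MonoidHom.ext fun v => ?_)
    simpa using DFunLike.congr_fun hcomp (e.symm v)
  obtain ⟨f, hf⟩ := Finite.surjective_of_injective hinj y
  have hwx' : FreeGroup.lift x' w = 1 := by
    apply (Subgroup.closure (Set.range x)).subtype_injective
    rw [map_one, ← hw, ← MonoidHom.comp_apply]
    congr 1
    ext i
    simp [x']
  have hy : FreeGroup.lift y =
      ((FreeGroup.lift f).comp e.toMonoidHom).comp (FreeGroup.lift x') := by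
    ext i
    simpa using (congrFun hf i).symm
  rw [hy, MonoidHom.comp_apply, hwx', map_one]

theorem lift_eq_one_of_mulEquiv [Finite ι] [Group.ResiduallyFinite H]
    (e : Subgroup.closure (Set.range x) ≃* FreeGroup ι) {w : FreeGroup ι}
    (hw : FreeGroup.lift x w = 1) (y : ι → H) : FreeGroup.lift y w = 1 := by
  refine Group.eq_one_iff_forall_finiteIndexNormalSubroup _ fun N => ?_
  have hN : QuotientGroup.mk' N.toSubgroup (FreeGroup.lift y w) = 1 := by
    rw [← lift_eq_one_of_mulEquiv_of_finite e hw (QuotientGroup.mk' N.toSubgroup ∘ y),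
      ← MonoidHom.comp_apply]
    congr 1
    ext i
    simp
  exact (QuotientGroup.eq_one_iff _).1 hN

instance residuallyFinite_specialLinearGroup_int {n : Type*} [Fintype n] [DecidableEq n] :
    Group.ResiduallyFinite (Matrix.SpecialLinearGroup n ℤ) := by
  refine Group.residuallyFinite_of_forall_exists_finite_monoidHom fun A hA => ?_
  obtain ⟨i, j, hij⟩ : ∃ i j, A i j ≠ (1 : Matrix.SpecialLinearGroup n ℤ) i j := by
    contrapose! hA
    exact Matrix.SpecialLinearGroup.ext _ _ hA
  set d := A i j - (1 : Matrix.SpecialLinearGroup n ℤ) i j with hd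
  refine ⟨Matrix.SpecialLinearGroup n (ZMod (d.natAbs + 1)), inferInstance, inferInstance,
    Matrix.SpecialLinearGroup.map (Int.castRingHom _), fun h => sub_ne_zero.2 hij ?_⟩
  have hmod : (d : ZMod (d.natAbs + 1)) = 0 := by
    rw [hd, Int.cast_sub, sub_eq_zero]
    exact congrArg (fun B : Matrix.SpecialLinearGroup n (ZMod (d.natAbs + 1)) => B i j)
      (h.trans (map_one (Matrix.SpecialLinearGroup.map (Int.castRingHom _))).symm)
  rw [ZMod.intCast_zmod_eq_zero_iff_dvd] at hmod
  exact Int.eq_zero_of_abs_lt_dvd hmod (by rw [Int.abs_eq_natAbs, ← hd]; push_cast; omega)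

end FreeGroup

section NestedCommutator

open scoped commutatorElement MatrixGroups

variable {G H : Type*} [Group G] [Group H]

/-- The commutator of the inverses of `s⁻¹ t ^ N s` and `t ^ N`; as a permutation it fixes the
points at which these two elements commute. -/
def nestedCommutator (s t : G) (N : ℕ) : G :=
  ⁅(s⁻¹ * t ^ N * s)⁻¹, (t ^ N)⁻¹⁆

theorem map_nestedCommutator (φ : G →* H) (s t : G) (N : ℕ) :
    φ (nestedCommutator s t N) = nestedCommutator (φ s) (φ t) N := by
  simp [nestedCommutator, map_commutatorElement]

theorem coe_nestedCommutator_S_T (N : ℕ) :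
    ((nestedCommutator ModularGroup.S ModularGroup.T N : SL(2, ℤ)) : Matrix (Fin 2) (Fin 2) ℤ) =
      !![1 + (N : ℤ) ^ 2, (N : ℤ) ^ 3; (N : ℤ) ^ 3, 1 - (N : ℤ) ^ 2 + (N : ℤ) ^ 4] := by
  simp only [nestedCommutator, commutatorElement_def, ← zpow_natCast,
    Matrix.SpecialLinearGroup.coe_mul, Matrix.SpecialLinearGroup.coe_inv, ModularGroup.coe_S,
    ModularGroup.coe_T_zpow]
  ext i j
  fin_cases i <;> fin_cases j <;> simp [Matrix.adjugate_fin_two] <;> ring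

theorem not_commute_nestedCommutator_S_T {N k : ℕ} (hN : N ≠ 0) (hk : k ≠ 0) :
    ¬ Commute (nestedCommutator ModularGroup.S ModularGroup.T N)
      (ModularGroup.T ^ k * nestedCommutator ModularGroup.S ModularGroup.T N *
        (ModularGroup.T ^ k)⁻¹) := by
  intro h
  have h10 := congrArg (fun A : SL(2, ℤ) => A 1 0) h.eq
  simp only [Matrix.SpecialLinearGroup.coe_mul, Matrix.SpecialLinearGroup.coe_inv, ← zpow_natCast,
    coe_nestedCommutator_S_T, ModularGroup.coe_T_zpow] at h10
  simp only [Matrix.adjugate_fin_two_of, Matrix.mul_fin_two, Matrix.of_apply, Matrix.cons_val_zero,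
    Matrix.cons_val_one] at h10
  have hzero : (2 * k * N ^ 6 : ℤ) = 0 := by linear_combination h10
  simp_all

theorem not_nonempty_mulEquiv_freeGroup_of_commute {s t : G} {N k : ℕ} (hN : N ≠ 0) (hk : k ≠ 0)
    (h : Commute (nestedCommutator s t N) (t ^ k * nestedCommutator s t N * (t ^ k)⁻¹)) :
    ¬ Nonempty (Subgroup.closure {s, t} ≃* FreeGroup (Fin 2)) := by
  rintro ⟨e⟩
  rw [← Matrix.range_cons_cons_empty s t ![]] at e
  let a : FreeGroup (Fin 2) := .of 0
  let b : FreeGroup (Fin 2) := .of 1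
  let w := ⁅nestedCommutator a b N, b ^ k * nestedCommutator a b N * (b ^ k)⁻¹⁆
  have hw : FreeGroup.lift ![s, t] w = 1 := by
    simpa [w, a, b, map_commutatorElement, map_nestedCommutator,
      commutatorElement_eq_one_iff_commute] using h
  have hw' := lift_eq_one_of_mulEquiv e hw ![ModularGroup.S, ModularGroup.T]
  apply not_commute_nestedCommutator_S_T hN hk
  simpa [w, a, b, map_commutatorElement, map_nestedCommutator,
    commutatorElement_eq_one_iff_commute] using hw'

end NestedCommutator


section Displacement

variable {α : Type*} {u g : Equiv.Perm α}

theorem commute_conj_of_displaced (h : ∀ x, u x = x ∨ u (g x) = g x) :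
    Commute u (g * u * g⁻¹) := by
  refine Equiv.Perm.Disjoint.commute fun y => ?_
  obtain ⟨x, rfl⟩ := g.surjective y
  exact (h x).symm.imp_right fun hx => by simp [hx]

theorem nestedCommutator_apply_eq_self {s t : Equiv.Perm α} {N : ℕ} {z : α}
    (h : (t ^ N) ((s⁻¹ * t ^ N * s) z) = (s⁻¹ * t ^ N * s) ((t ^ N) z)) :
    nestedCommutator s t N z = z := by
  have hu : nestedCommutator s t N =
      (t ^ N * (s⁻¹ * t ^ N * s))⁻¹ * (s⁻¹ * t ^ N * s * t ^ N) := by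
    rw [nestedCommutator, commutatorElement_def]
    group
  rw [hu, Equiv.Perm.mul_apply, Equiv.Perm.inv_eq_iff_eq, Equiv.Perm.mul_apply _ (t ^ N),
    Equiv.Perm.mul_apply (t ^ N), h]

end Displacement

section TranslatesOn

variable {X : Set ℝ}

/-- `f` is the translation by `c` at the points of its domain that lie in `s`. -/
def TranslatesOn (f : X → X) (c : ℝ) (s : Set ℝ) : Prop :=
  ∀ x : X, (x : ℝ) ∈ s → (f x : ℝ) = x + c

theorem TranslatesOn.mono {f : X → X} {c : ℝ} {s s' : Set ℝ} (h : TranslatesOn f c s)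
    (hs : s' ⊆ s) : TranslatesOn f c s' :=
  fun x hx => h x (hs hx)

variable {g S : Equiv.Perm X} {z : X} {c c' s C : ℝ}

theorem TranslatesOn.conj (hX : Set.Icc (z : ℝ) (z + 2 * C) ⊆ X)
    (hS : TranslatesOn S s (Set.Icc z (z + 2 * C))) (hc : c ∈ Set.Icc 0 C)
    (hg : TranslatesOn g c (Set.Icc (S z) (S z + C))) :
    TranslatesOn (S⁻¹ * g * S) c (Set.Icc z (z + C)) := by
  intro y hy
  obtain ⟨hc0, hcC⟩ := hc
  obtain ⟨hzy, hyz⟩ := hy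
  have hSz := hS z ⟨le_rfl, by linarith⟩
  have hSy := hS y ⟨hzy, by linarith⟩
  have hw : y + c ∈ Set.Icc (z : ℝ) (z + 2 * C) := ⟨by linarith, by linarith⟩
  have hgS : g (S y) = S ⟨y + c, hX hw⟩ := by
    apply Subtype.ext
    rw [hg (S y) ⟨by linarith, by linarith⟩, hS ⟨y + c, hX hw⟩ hw, hSy]
    ring
  rw [Equiv.Perm.mul_apply, Equiv.Perm.mul_apply, hgS, Equiv.Perm.inv_def, Equiv.symm_apply_apply]

theorem apply_conj_comm_of_translatesOn (hX : Set.Icc (z : ℝ) (z + 2 * C) ⊆ X)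
    (hS : TranslatesOn S s (Set.Icc z (z + 2 * C)))
    (hc : c ∈ Set.Icc 0 C) (hg : TranslatesOn g c (Set.Icc z (z + C)))
    (hc' : c' ∈ Set.Icc 0 C) (hg' : TranslatesOn g c' (Set.Icc (S z) (S z + C))) :
    g ((S⁻¹ * g * S) z) = (S⁻¹ * g * S) (g z) := by
  have hh := TranslatesOn.conj hX hS hc' hg'
  obtain ⟨hc0, hcC⟩ := hc
  obtain ⟨hc0', hcC'⟩ := hc'
  have hgz := hg z ⟨le_rfl, by linarith⟩
  have hhz := hh z ⟨le_rfl, by linarith⟩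
  apply Subtype.ext
  rw [hg ((S⁻¹ * g * S) z) ⟨by linarith, by linarith⟩, hh (g z) ⟨by linarith, by linarith⟩,
    hgz, hhz]
  ring

end TranslatesOn

section Cells

variable {κ b : ℝ} {m m' : ℤ} {q : ℕ}

/-- The interval `[m κ, (m + 1) κ]` with a margin of width `b` removed on both sides. -/
def cell (κ b : ℝ) (m : ℤ) : Set ℝ := Set.Icc (m * κ + b) ((m + 1) * κ - b)

theorem cell_anti {b' : ℝ} (hb : b ≤ b') : cell κ b' m ⊆ cell κ b m :=
  Set.Icc_subset_Icc (by linarith) (by linarith)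

theorem Icc_add_subset_cell {x r : ℝ} (hr : 0 ≤ r) (hx : x ∈ cell κ (b + r) m) :
    Set.Icc x (x + r) ⊆ cell κ b m :=
  Set.Icc_subset_Icc (by linarith [hx.1]) (by linarith [hx.2])

theorem add_mem_cell {x r c : ℝ} (hx : x ∈ cell κ (b + r) m) (hc : c ∈ Set.Icc 0 r) :
    x + ((m' - m) * κ + c) ∈ cell κ b m' := by
  obtain ⟨hx, hx'⟩ := hx
  obtain ⟨hc, hc'⟩ := hc
  constructor <;> linarith

theorem midpoint_add_mem_cell {c : ℝ} (hc : |c| + b ≤ κ / 2) :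
    (m + 1 / 2) * κ + c ∈ cell κ b m := by
  obtain ⟨hc₁, hc₂⟩ := abs_le.1 (le_sub_iff_add_le.2 hc)
  constructor <;> linarith

theorem le_of_mem_cell (hκ : 0 < κ) (hb : 0 < b) {x : ℝ} (hx : x ∈ cell κ b m)
    (hx' : x ∈ cell κ b m') : m ≤ m' := by
  have h : m * κ < (m' + 1) * κ := by linarith [hx.1, hx'.2]
  exact Int.lt_add_one_iff.1 (by exact_mod_cast lt_of_mul_lt_mul_right h hκ.le)

theorem eq_of_mem_cell (hκ : 0 < κ) (hb : 0 < b) {x : ℝ} (hx : x ∈ cell κ b m)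
    (hx' : x ∈ cell κ b m') : m = m' :=
  le_antisymm (le_of_mem_cell hκ hb hx hx') (le_of_mem_cell hκ hb hx' hx)

theorem exists_mem_cell (hκ : 0 < κ) {x : ℝ} (hx : ∀ m : ℤ, b ≤ |x - m * κ|) :
    ∃ m, x ∈ cell κ b m := by
  have hle := (le_div_iff₀ hκ).1 (Int.floor_le (x / κ))
  have hlt := (div_lt_iff₀ hκ).1 (Int.lt_floor_add_one (x / κ))
  have hleft := hx ⌊x / κ⌋
  have hright := hx (⌊x / κ⌋ + 1)
  push_cast at hright
  rw [abs_of_nonneg (by linarith)] at hleft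
  rw [abs_of_nonpos (by linarith)] at hright
  exact ⟨_, by linarith, by linarith⟩

theorem pos_of_natCast_mul_eq_one (hq : q * κ = 1) : 0 < κ :=
  pos_of_mul_pos_right (hq ▸ one_pos) q.cast_nonneg

theorem cell_subset_Ico (hq : q * κ = 1) (hb : 0 < b) (m : Fin q) :
    cell κ b (m : ℕ) ⊆ Set.Ico 0 1 := by
  rintro x ⟨hx, hx'⟩
  have hκ := pos_of_natCast_mul_eq_one hq
  have hm : 0 ≤ (m : ℕ) * κ := by positivity
  have hm' : ((m : ℕ) + 1) * κ ≤ q * κ := by gcongr; exact_mod_cast m.2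
  push_cast at hx hx'
  constructor <;> linarith

theorem exists_fin_of_mem_cell (hq : q * κ = 1) (hb : 0 < b) {x : ℝ} (hx : x ∈ cell κ b m)
    (hx01 : x ∈ Set.Ico (0 : ℝ) 1) : ∃ j : Fin q, ((j : ℕ) : ℤ) = m := by
  have hκ := pos_of_natCast_mul_eq_one hq
  have hm : 0 * κ < (m + 1) * κ := by linarith [hx.2, hx01.1]
  have hm' : m * κ < q * κ := by linarith [hx.1, hx01.2]
  have hm₁ : 0 < m + 1 := by exact_mod_cast lt_of_mul_lt_mul_right hm hκ.le
  have hm₂ : m < q := by exact_mod_cast lt_of_mul_lt_mul_right hm' hκ.le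
  exact ⟨⟨m.toNat, by omega⟩, by simp; omega⟩

end Cells

section Drift

variable {X : Set ℝ} {κ a b : ℝ}

/-- Modulo `κ`, the map `f` moves every point to the right by an amount between `a` and `b`. -/
def DriftsMod (κ a b : ℝ) (f : X → X) : Prop :=
  ∀ x, ∃ p : ℤ, (f x : ℝ) - x - p * κ ∈ Set.Icc a b

/-- The map `f` is a translation on each of the cells `cell κ b m`; the translation lengths may
depend on the cell. -/
def TranslatesCells (κ b : ℝ) (f : X → X) : Prop :=
  ∀ m : ℤ, ∃ c, TranslatesOn f c (cell κ b m)

/-- The point `x` has distance at least `δ` from `E`, modulo `κ`. -/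
def IsFar (κ : ℝ) (E : Finset ℝ) (δ x : ℝ) : Prop :=
  ∀ e ∈ E, ∀ m : ℤ, δ ≤ |x - e - m * κ|

/-- Points of `E` that are distinct modulo `κ` have distance at least `γ` modulo `κ`, and `γ ≤ κ`
unless `E` is empty. -/
def HasGap (κ : ℝ) (E : Finset ℝ) (γ : ℝ) : Prop :=
  ∀ e ∈ E, ∀ e' ∈ E, ∀ m : ℤ, 0 < e' - e - m * κ → γ ≤ e' - e - m * κ

theorem exists_hasGap (hκ : 0 < κ) (E : Finset ℝ) : ∃ γ > 0, HasGap κ E γ := by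
  have hgap : ∀ᶠ γ in nhdsWithin (0 : ℝ) (Set.Ioi 0),
      ∀ e ∈ E, ∀ e' ∈ E, γ ≤ toIocMod hκ 0 (e' - e) := by
    simp only [Filter.eventually_all_finset]
    exact fun e _ e' _ => (eventually_le_nhds (left_lt_toIocMod hκ 0 _)).filter_mono
      nhdsWithin_le_nhds
  obtain ⟨γ, hγ, hγ0⟩ := (hgap.and self_mem_nhdsWithin).exists
  refine ⟨γ, hγ0, fun e he e' he' m hm => (hγ e he e' he').trans ?_⟩
  rw [← toIocMod_sub_zsmul hκ 0 (e' - e) m, zsmul_eq_mul]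
  rcases le_or_gt (e' - e - m * κ) κ with h | h
  · exact ((toIocMod_eq_self hκ).2 ⟨hm, by rwa [zero_add]⟩).le
  · exact (toIocMod_le_right hκ 0 _).trans (by linarith)

theorem DriftsMod.pow {T : Equiv.Perm X} (h : DriftsMod κ a b T) (k : ℕ) :
    DriftsMod κ (k * a) (k * b) ⇑(T ^ k) := by
  induction k with
  | zero => exact fun x => ⟨0, by simp⟩
  | succ k ih =>
    intro x
    obtain ⟨p, hp, hp'⟩ := ih x
    obtain ⟨p', hp₁, hp₁'⟩ := h ((T ^ k) x)
    refine ⟨p + p', ?_⟩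
    rw [pow_succ', Equiv.Perm.mul_apply, Nat.cast_succ, Int.cast_add]
    constructor <;> linarith

theorem DriftsMod.isFar_or_isFar {f : X → X} (h : DriftsMod κ a b f) {E : Finset ℝ} {γ δ : ℝ}
    (hγ : HasGap κ E γ) (ha : 2 * δ ≤ a) (hb : b + 2 * δ ≤ γ) (x : X) :
    IsFar κ E δ x ∨ IsFar κ E δ (f x) := by
  by_contra! hnear
  simp only [IsFar, not_forall, not_le, abs_lt] at hnear
  obtain ⟨⟨e, he, m, hm⟩, e', he', m', hm'⟩ := hnear
  obtain ⟨p, hp, hp'⟩ := h x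
  have hee' := hγ e he e' he' (p + m - m') (by push_cast; linarith)
  push_cast at hee'
  linarith

end Drift

section CellPermutation

variable {κ a b : ℝ} {q : ℕ} {T : Equiv.Perm (Set.Ico (0 : ℝ) 1)}

theorem DriftsMod.exists_translatesOn_cell (hT : DriftsMod κ a b T) (hq : q * κ = 1) (ha : 0 ≤ a)
    (hb0 : 0 < b) (hb : 4 * b < κ) (hT' : TranslatesCells κ b T) (m : Fin q) :
    ∃ j : Fin q, ∃ c ∈ Set.Icc a b, TranslatesOn T ((j - m) * κ + c) (cell κ b (m : ℕ)) := by
  obtain ⟨s, hs⟩ := hT' (m : ℕ)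
  have hmem : ((m : ℕ) + 1 / 2) * κ ∈ cell κ b (m : ℕ) := by
    simpa using midpoint_add_mem_cell (m := (m : ℕ)) (c := 0) (by rw [abs_zero]; linarith)
  let x : Set.Ico (0 : ℝ) 1 := ⟨_, cell_subset_Ico hq hb0 m hmem⟩
  obtain ⟨p, hp⟩ := hT x
  have hTx : (T x : ℝ) ∈ cell κ b (m + p) := by
    convert midpoint_add_mem_cell (m := m + p) (c := (T x : ℝ) - x - p * κ) ?_ using 1
    · simp only [x]
      push_cast
      ring
    · rw [abs_of_nonneg (ha.trans hp.1)]
      linarith [hp.2]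
  obtain ⟨j, hj⟩ := exists_fin_of_mem_cell hq hb0 hTx (T x).2
  have hjm : (j : ℝ) = m + p := by exact_mod_cast hj
  refine ⟨j, _, hp, ?_⟩
  convert hs using 1
  rw [hs x hmem, hjm]
  ring

/-- The midpoint of the image cell is the image of a point of the original cell, so the map on
cells is injective. -/
theorem DriftsMod.exists_perm_cells (hT : DriftsMod κ a b T) (hq : q * κ = 1) (ha : 0 ≤ a)
    (hb0 : 0 < b) (hb : 4 * b < κ) (hT' : TranslatesCells κ b T) :
    ∃ (f : Equiv.Perm (Fin q)) (c : Fin q → ℝ), (∀ m, c m ∈ Set.Icc a b) ∧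
      ∀ m, TranslatesOn T ((f m - m) * κ + c m) (cell κ b (m : ℕ)) := by
  choose f c hc hf using hT.exists_translatesOn_cell hq ha hb0 hb hT'
  have hmem : ∀ m : Fin q, ((m : ℕ) + 1 / 2) * κ - c m ∈ cell κ b (m : ℕ) := fun m => by
    convert midpoint_add_mem_cell (m := (m : ℕ)) (c := -c m) ?_ using 1
    · push_cast
      ring
    · rw [abs_neg, abs_of_nonneg (ha.trans (hc m).1)]
      linarith [(hc m).2]
  let x (m : Fin q) : Set.Ico (0 : ℝ) 1 := ⟨_, cell_subset_Ico hq hb0 m (hmem m)⟩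
  have hTx : ∀ m, (T (x m) : ℝ) = ((f m : ℕ) + 1 / 2) * κ := fun m => by
    rw [hf m (x m) (hmem m)]
    simp only [x]
    ring
  have hinj : Function.Injective f := by
    intro m m' hmm'
    have hxx' : x m = x m' := T.injective (Subtype.ext (by rw [hTx, hTx, hmm']))
    have hmem' : (x m : ℝ) ∈ cell κ b (m' : ℕ) := hxx' ▸ hmem m'
    exact Fin.ext (by
      exact_mod_cast eq_of_mem_cell (pos_of_natCast_mul_eq_one hq) hb0 (hmem m) hmem')
  exact ⟨Equiv.ofBijective f hinj.bijective_of_finite, c, hc, hf⟩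

theorem exists_pow_translatesOn_cell {f : Equiv.Perm (Fin q)} {c : Fin q → ℝ}
    (hc : ∀ m, c m ∈ Set.Icc 0 b)
    (hf : ∀ m, TranslatesOn T ((f m - m) * κ + c m) (cell κ b (m : ℕ))) (j : ℕ) (m : Fin q) :
    ∃ s ∈ Set.Icc 0 (j * b),
      TranslatesOn ⇑(T ^ j) (((f ^ j) m - m) * κ + s) (cell κ ((j + 1) * b) (m : ℕ)) := by
  induction j generalizing m with
  | zero => exact ⟨0, by simp, fun x _ => by simp⟩
  | succ j ih =>
    obtain ⟨s, hs, hsT⟩ := ih (f m)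
    have hb : 0 ≤ b := (hc m).1.trans (hc m).2
    refine ⟨c m + s, ⟨add_nonneg (hc m).1 hs.1, ?_⟩, fun x hx => ?_⟩
    · push_cast
      linarith [(hc m).2, hs.2]
    · have hTx := hf m x (cell_anti
        (le_mul_of_one_le_left hb (le_add_of_nonneg_left (Nat.cast_nonneg _))) hx)
      have hmem : (T x : ℝ) ∈ cell κ ((j + 1) * b) (f m : ℕ) := by
        rw [hTx]
        refine add_mem_cell (m := (m : ℕ)) (r := b) ?_ (hc m)
        convert hx using 2
        push_cast
        ring
      rw [pow_succ, pow_succ, Equiv.Perm.mul_apply, Equiv.Perm.mul_apply, hsT (T x) hmem, hTx]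
      ring

/-- The power `q !` kills the permutation of the `q` cells and only leaves the small drift. -/
theorem DriftsMod.exists_pow_factorial_translatesOn_cell (hT : DriftsMod κ a b T) (hq : q * κ = 1)
    (ha : 0 ≤ a) (hb0 : 0 < b) (hb : 4 * b < κ) (hT' : TranslatesCells κ b T) (m : ℤ) :
    ∃ s ∈ Set.Icc 0 (q.factorial * b),
      TranslatesOn ⇑(T ^ q.factorial) s (cell κ ((q.factorial + 1) * b) m) := by
  by_cases hm : ∃ j : Fin q, ((j : ℕ) : ℤ) = m
  · obtain ⟨j, rfl⟩ := hm
    obtain ⟨f, c, hc, hf⟩ := hT.exists_perm_cells hq ha hb0 hb hT'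
    obtain ⟨s, hs, hsT⟩ := exists_pow_translatesOn_cell
      (fun m => Set.Icc_subset_Icc_left ha (hc m)) hf q.factorial j
    have hfq : f ^ q.factorial = 1 := by
      simpa [Fintype.card_perm] using pow_card_eq_one' (x := f)
    exact ⟨s, hs, by simpa [hfq] using hsT⟩
  · exact ⟨0, ⟨le_rfl, by positivity⟩, fun x hx =>
      absurd (exists_fin_of_mem_cell hq (by positivity) hx x.2) hm⟩

end CellPermutation

section Relation

variable {κ a b C γ : ℝ} {q k : ℕ} {E : Finset ℝ} {S T g : Equiv.Perm (Set.Ico (0 : ℝ) 1)}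

/-- Every point `z` starts a half-open interval on which `S` is a translation; the right endpoints
of these intervals and the opposites of the translation lengths belong to `E`. -/
def IsPiecewiseTranslation {X : Set ℝ} (S : X → X) (E : Finset ℝ) : Prop :=
  ∀ z : X, ∃ c e, -c ∈ E ∧ e ∈ E ∧ (z : ℝ) < e ∧ TranslatesOn S c (Set.Ico z e)

theorem IsPiecewiseTranslation.apply_conj_comm (hS : IsPiecewiseTranslation S E) (hE : 0 ∈ E)
    (hq : q * κ = 1) (hC : 0 < C)
    (hg : ∀ m, ∃ c ∈ Set.Icc 0 C, TranslatesOn g c (cell κ C m))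
    {z : Set.Ico (0 : ℝ) 1} (hz : IsFar κ E (3 * C) z) :
    g ((S⁻¹ * g * S) z) = (S⁻¹ * g * S) (g z) := by
  have hκ := pos_of_natCast_mul_eq_one hq
  obtain ⟨s, e, hs, he, hze, hSe⟩ := hS z
  have hSz : (S z : ℝ) = z + s := hSe z ⟨le_rfl, hze⟩
  have he3 : z + 3 * C ≤ e := by
    have := hz e he 0
    rw [Int.cast_zero, zero_mul, sub_zero, abs_sub_comm, abs_of_nonneg (by linarith)] at this
    linarith
  have hz3 : z + 3 * C ≤ 1 := by
    have := hz 0 hE q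
    rw [Int.cast_natCast, hq, sub_zero, abs_sub_comm, abs_of_nonneg (by linarith [z.2.2])] at this
    linarith
  obtain ⟨m, hm⟩ := exists_mem_cell hκ (x := z) (b := 3 * C) fun m => by simpa using hz 0 hE m
  obtain ⟨m', hSm⟩ := exists_mem_cell hκ (x := S z) (b := 3 * C) fun m => by
    simpa [hSz] using hz (-s) hs m
  obtain ⟨c, hc, hgc⟩ := hg m
  obtain ⟨c', hc', hgc'⟩ := hg m'
  have hCC : C + C ≤ 3 * C := by linarith
  refine apply_conj_comm_of_translatesOn (s := s) (C := C)
    (fun x hx => ⟨z.2.1.trans hx.1, by linarith [hx.2]⟩)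
    (hSe.mono fun x hx => ⟨hx.1, by linarith [hx.2]⟩)
    hc (hgc.mono (Icc_add_subset_cell hC.le (cell_anti hCC hm)))
    hc' (hgc'.mono (Icc_add_subset_cell hC.le (cell_anti hCC hSm)))

/-- The nested commutator is supported near `E` modulo `κ`, and `T ^ k` moves this support off
itself. -/
theorem DriftsMod.commute_nestedCommutator (hT : DriftsMod κ a b T) (hq : q * κ = 1) (ha : 0 ≤ a)
    (hb0 : 0 < b) (hb : 4 * b < κ) (hT' : TranslatesCells κ b T)
    (hS : IsPiecewiseTranslation S E) (hE : 0 ∈ E) (hγ : HasGap κ E γ)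
    (hka : 6 * ((q.factorial + 1) * b) ≤ k * a) (hkb : k * b + 6 * ((q.factorial + 1) * b) ≤ γ) :
    Commute (nestedCommutator S T q.factorial)
      (T ^ k * nestedCommutator S T q.factorial * (T ^ k)⁻¹) := by
  have hg : ∀ m, ∃ c ∈ Set.Icc 0 ((q.factorial + 1) * b),
      TranslatesOn ⇑(T ^ q.factorial) c (cell κ ((q.factorial + 1) * b) m) := fun m => by
    obtain ⟨c, hc, hcT⟩ := hT.exists_pow_factorial_translatesOn_cell hq ha hb0 hb hT' m
    exact ⟨c, Set.Icc_subset_Icc_right (by gcongr; simp) hc, hcT⟩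
  have hfix : ∀ z : Set.Ico (0 : ℝ) 1, IsFar κ E (3 * ((q.factorial + 1) * b)) z →
      nestedCommutator S T q.factorial z = z := fun z hz =>
    nestedCommutator_apply_eq_self (hS.apply_conj_comm hE hq (by positivity) hg hz)
  exact commute_conj_of_displaced fun z =>
    ((hT.pow k).isFar_or_isFar hγ (by linarith) (by linarith) z).imp (hfix z) (hfix _)

end Relation

section Rearrangement

variable {ι α M : Type*} [LinearOrder α] {r r' : ι → α} {l : ι → ℝ} {x : ℝ}

theorem exists_sum_filter_le_lt (hr : Function.Injective r) (s : Finset ι) (hx : 0 ≤ x)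
    (hxs : x < ∑ j ∈ s, l j) :
    ∃ i ∈ s, ∑ j ∈ s with r j < r i, l j ≤ x ∧ x < ∑ j ∈ s with r j < r i, l j + l i := by
  classical
  induction s using Finset.induction_on_max_value r with
  | empty =>
    rw [Finset.sum_empty] at hxs
    exact absurd hxs hx.not_gt
  | insert a s ha hs ih =>
    rcases lt_or_ge x (∑ j ∈ s, l j) with hlt | hge
    · obtain ⟨i, hi, hxi⟩ := ih hlt
      refine ⟨i, Finset.mem_insert_of_mem hi, ?_⟩
      rwa [Finset.filter_insert, if_neg (hs i hi).not_gt]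
    · refine ⟨a, Finset.mem_insert_self a s, ?_⟩
      have hfilter : s.filter (r · < r a) = s := Finset.filter_true_of_mem fun j hj =>
        (hs j hj).lt_of_ne (hr.ne (ne_of_mem_of_not_mem hj ha))
      rw [Finset.filter_insert, if_neg (lt_irrefl _), hfilter]
      rw [Finset.sum_insert ha] at hxs
      exact ⟨hge, by linarith⟩

variable [Fintype ι]

/-- The total length of the intervals that lie to the left of the `i`-th one when intervals with
lengths `l` are lined up in the order given by the ranks `r`. -/
def offset [AddCommMonoid M] (r : ι → α) (l : ι → M) (i : ι) : M := ∑ j with r j < r i, l j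

/-- The amount by which the `i`-th interval moves when intervals with lengths `l` are rearranged
from the order given by `r` to the order given by `r'`. -/
def displacement [AddCommGroup M] (r r' : ι → α) (l : ι → M) (i : ι) : M :=
  offset r' l i - offset r l i

/-- The `i`-th interval when half-open intervals with lengths `l` are lined up from `0` on in the
order given by the ranks `r`. -/
def slot (r : ι → α) (l : ι → ℝ) (i : ι) : Set ℝ := Set.Ico (offset r l i) (offset r l i + l i)

/-- `f` rearranges intervals with lengths `l` from the order given by `r` to the order given by
`r'`. -/
def Rearranges {X : Set ℝ} (f : X → X) (r r' : ι → α) (l : ι → ℝ) : Prop :=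
  ∀ i, TranslatesOn f (displacement r r' l i) (slot r l i)

theorem offset_add_self [DecidableEq ι] (r : ι → α) (l : ι → ℝ) (i : ι) :
    offset r l i + l i = ∑ j ∈ insert i (Finset.univ.filter fun j => r j < r i), l j := by
  rw [Finset.sum_insert (by simp), add_comm, offset]

theorem offset_add_self_le (hl : ∀ i, 0 ≤ l i) {i j : ι} (hij : r i < r j) :
    offset r l i + l i ≤ offset r l j := by
  classical
  rw [offset_add_self]
  refine Finset.sum_le_sum_of_subset_of_nonneg (fun k hk => ?_) fun k _ _ => hl k
  simp only [Finset.mem_insert, Finset.mem_filter_univ] at hk ⊢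
  rcases hk with rfl | hk
  exacts [hij, hk.trans hij]

theorem slot_subset_Ico (hl : ∀ i, 0 ≤ l i) (hsum : ∑ i, l i = 1) (r : ι → α) (i : ι) :
    slot r l i ⊆ Set.Ico 0 1 := by
  classical
  refine Set.Ico_subset_Ico (Finset.sum_nonneg fun j _ => hl j) ?_
  rw [offset_add_self, ← hsum]
  exact Finset.sum_le_univ_sum_of_nonneg hl

theorem eq_of_mem_slot (hr : Function.Injective r) (hl : ∀ i, 0 ≤ l i) {i j : ι}
    (hi : x ∈ slot r l i) (hj : x ∈ slot r l j) : i = j := by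
  by_contra hij
  rcases (hr.ne hij).lt_or_gt with h | h
  · linarith [offset_add_self_le hl h, hi.2, hj.1]
  · linarith [offset_add_self_le hl h, hi.1, hj.2]

theorem exists_mem_slot (hr : Function.Injective r) (hsum : ∑ i, l i = 1)
    (hx : x ∈ Set.Ico (0 : ℝ) 1) : ∃ i, x ∈ slot r l i := by
  obtain ⟨i, -, hi⟩ := exists_sum_filter_le_lt hr Finset.univ hx.1 (hsum ▸ hx.2)
  exact ⟨i, hi⟩

theorem add_displacement_mem_slot {i : ι} (hx : x ∈ slot r l i) :
    x + displacement r r' l i ∈ slot r' l i := by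
  obtain ⟨hx, hx'⟩ := hx
  rw [displacement]
  constructor <;> linarith

theorem exists_rearranges (hr : Function.Injective r) (r' : ι → α) (hl : ∀ i, 0 ≤ l i)
    (hsum : ∑ i, l i = 1) : ∃ f : Set.Ico (0 : ℝ) 1 → Set.Ico (0 : ℝ) 1, Rearranges f r r' l := by
  choose i hi using fun x : Set.Ico (0 : ℝ) 1 => exists_mem_slot hr hsum x.2
  refine ⟨fun x => ⟨x + displacement r r' l (i x),
    slot_subset_Ico hl hsum r' _ (add_displacement_mem_slot (hi x))⟩, fun j x hx => ?_⟩
  rw [eq_of_mem_slot hr hl hx (hi x)]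

theorem Rearranges.leftInverse {f g : Set.Ico (0 : ℝ) 1 → Set.Ico (0 : ℝ) 1}
    (hf : Rearranges f r r' l) (hg : Rearranges g r' r l) (hr : Function.Injective r)
    (hsum : ∑ i, l i = 1) : Function.LeftInverse g f := by
  intro x
  obtain ⟨i, hi⟩ := exists_mem_slot hr hsum x.2
  have hfx := hf i x hi
  have hgfx := hg i (f x) (hfx ▸ add_displacement_mem_slot hi)
  apply Subtype.ext
  rw [hgfx, hfx, displacement, displacement]
  ring

theorem exists_perm_rearranges (hr : Function.Injective r) (hr' : Function.Injective r')
    (hl : ∀ i, 0 ≤ l i) (hsum : ∑ i, l i = 1) :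
    ∃ f : Equiv.Perm (Set.Ico (0 : ℝ) 1), Rearranges f r r' l := by
  obtain ⟨f, hf⟩ := exists_rearranges hr r' hl hsum
  obtain ⟨g, hg⟩ := exists_rearranges hr' r hl hsum
  exact ⟨⟨f, g, hf.leftInverse hg hr hsum, hg.leftInverse hf hr' hsum⟩, hf⟩

end Rearrangement

section Perturbation

variable {ι α : Type*} [Fintype ι] [LinearOrder α] {r r' : ι → α} {l c : ι → ℝ} {a : ι → ℤ}
  {κ b t ε : ℝ} {f : Set.Ico (0 : ℝ) 1 → Set.Ico (0 : ℝ) 1}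

theorem Rearranges.driftsMod {a : ℝ} (hf : Rearranges f r r' l) (hr : Function.Injective r)
    (hsum : ∑ i, l i = 1)
    (h : ∀ i, ∃ p : ℤ, displacement r r' l i - p * κ ∈ Set.Icc a b) : DriftsMod κ a b f := by
  intro x
  obtain ⟨i, hi⟩ := exists_mem_slot hr hsum x.2
  rw [hf i x hi, add_sub_cancel_left]
  exact h i

theorem cell_subset_Ico_of_mem (hκ : 0 < κ) {u v : ℝ} (hu : ∃ p : ℤ, |u - p * κ| < b)
    (hv : ∃ p : ℤ, |v - p * κ| < b) {m : ℤ} {x : ℝ} (hx : x ∈ cell κ b m)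
    (hxuv : x ∈ Set.Ico u v) : cell κ b m ⊆ Set.Ico u v := by
  obtain ⟨p, hp⟩ := hu
  obtain ⟨p', hp'⟩ := hv
  rw [abs_lt] at hp hp'
  have hpm : p * κ < (m + 1) * κ := by linarith [hx.2, hxuv.1]
  have hmp : m * κ < p' * κ := by linarith [hx.1, hxuv.2]
  have hpm' : p ≤ m :=
    Int.lt_add_one_iff.1 (by exact_mod_cast lt_of_mul_lt_mul_right hpm hκ.le)
  have hmp' : m + 1 ≤ p' :=
    Int.add_one_le_iff.2 (by exact_mod_cast lt_of_mul_lt_mul_right hmp hκ.le)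
  have hle : p * κ ≤ m * κ := by gcongr
  have hle' : (m + 1) * κ ≤ p' * κ := by gcongr; exact_mod_cast hmp'
  exact fun y hy => ⟨by linarith [hy.1], by linarith [hy.2]⟩

theorem Rearranges.translatesCells (hf : Rearranges f r r' l) (hr : Function.Injective r)
    (hsum : ∑ i, l i = 1) (hκ : 0 < κ)
    (h : ∀ s : Finset ι, ∃ p : ℤ, |∑ j ∈ s, l j - p * κ| < b) : TranslatesCells κ b f := by
  classical
  intro m
  by_cases hm : ∃ x : Set.Ico (0 : ℝ) 1, (x : ℝ) ∈ cell κ b m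
  · obtain ⟨x, hx⟩ := hm
    obtain ⟨i, hi⟩ := exists_mem_slot hr hsum x.2
    exact ⟨_, (hf i).mono (cell_subset_Ico_of_mem hκ (h _) (offset_add_self r l i ▸ h _) hx hi)⟩
  · exact ⟨0, fun x hx => absurd ⟨x, hx⟩ hm⟩

theorem abs_sum_sub_lt (h : ∑ j, |l j - (a j * κ + t * c j)| < ε) (s : Finset ι) :
    |∑ j ∈ s, l j - ((∑ j ∈ s, a j : ℤ) * κ + t * ∑ j ∈ s, c j)| < ε := by
  have hsum : ∑ j ∈ s, l j - ((∑ j ∈ s, a j : ℤ) * κ + t * ∑ j ∈ s, c j) =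
      ∑ j ∈ s, (l j - (a j * κ + t * c j)) := by
    rw [Finset.sum_sub_distrib, Finset.sum_add_distrib, Finset.mul_sum, Int.cast_sum,
      Finset.sum_mul]
  rw [hsum]
  exact (Finset.abs_sum_le_sum_abs _ _).trans_lt
    ((Finset.sum_le_univ_sum_of_nonneg fun _ => abs_nonneg _).trans_lt h)

theorem abs_mul_sum_le (ht : 0 ≤ t) (s : Finset ι) :
    |t * ∑ j ∈ s, c j| ≤ (∑ j, |c j|) * t := by
  rw [abs_mul, abs_of_nonneg ht, mul_comm]
  gcongr
  exact (Finset.abs_sum_le_sum_abs _ _).trans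
    (Finset.sum_le_univ_sum_of_nonneg fun _ => abs_nonneg _)

theorem Rearranges.driftsMod_of_perturbation (hf : Rearranges f r r' l)
    (hr : Function.Injective r) (hsum : ∑ i, l i = 1) (ht : 0 ≤ t)
    (hc : ∀ i, 1 ≤ displacement r r' c i)
    (h : ∑ j, |l j - (a j * κ + t * c j)| < t / 4) :
    DriftsMod κ (t / 2) ((2 * ∑ j, |c j| + 1) * t) f := by
  refine hf.driftsMod hr hsum fun i => ⟨displacement r r' a i, ?_⟩
  have herr := abs_lt.1 (abs_sum_sub_lt h {j | r j < r i})
  have herr' := abs_lt.1 (abs_sum_sub_lt h {j | r' j < r' i})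
  have hle := abs_le.1 (abs_mul_sum_le (c := c) ht {j | r j < r i})
  have hle' := abs_le.1 (abs_mul_sum_le (c := c) ht {j | r' j < r' i})
  have hdrift := mul_le_mul_of_nonneg_left (hc i) ht
  simp only [displacement, offset, Int.cast_sub] at hdrift ⊢
  constructor <;> linarith

theorem Rearranges.translatesCells_of_perturbation (hf : Rearranges f r r' l)
    (hr : Function.Injective r) (hsum : ∑ i, l i = 1) (hκ : 0 < κ) (ht : 0 ≤ t)
    (h : ∑ j, |l j - (a j * κ + t * c j)| < t / 4) :
    TranslatesCells κ ((2 * ∑ j, |c j| + 1) * t) f := by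
  refine hf.translatesCells hr hsum hκ fun s => ⟨∑ j ∈ s, a j, ?_⟩
  have herr := abs_lt.1 (abs_sum_sub_lt h s)
  have hle := abs_le.1 (abs_mul_sum_le (c := c) ht s)
  have : 0 ≤ (∑ j, |c j|) * t := by positivity
  rw [abs_lt]
  constructor <;> linarith

end Perturbation

section Admissible

variable {ι M : Type*} [LinearOrder ι] {i : ι}

theorem apply_eq_self_and_image_Iic_eq {σ : Equiv.Perm ι} (h : σ '' Set.Iio i = Set.Iio i)
    (h' : σ ⁻¹' Set.Iio (σ i) = Set.Iio (σ i)) : σ i = i ∧ σ '' Set.Iic i = Set.Iic i := by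
  have hle : i ≤ σ i := not_lt.1 fun hlt => by
    rw [← Set.mem_Iio, ← h, σ.injective.mem_set_image] at hlt
    exact lt_irrefl i hlt
  have hge : σ i ≤ i := not_lt.1 fun hlt => by
    rw [← Set.mem_Iio, ← h'] at hlt
    exact lt_irrefl (σ i) hlt
  have hfix := hge.antisymm hle
  exact ⟨hfix, by rw [← Set.Iio_insert, Set.image_insert_eq, h, hfix]⟩

variable [LocallyFiniteOrderBot ι] [AddCommGroup M]

theorem displacement_id_perm_eq [Fintype ι] (f : ι → M) (σ : Equiv.Perm ι) (i : ι) :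
    displacement id σ (fun j => f j - f (σ j)) i =
      (∑ j with σ j < σ i, f j - ∑ j ∈ Finset.Iio (σ i), f j) +
        (∑ j ∈ (Finset.Iio i).map σ.toEmbedding, f j - ∑ j ∈ Finset.Iio i, f j) := by
  have himage : ∑ j with σ j < σ i, f (σ j) = ∑ j ∈ Finset.Iio (σ i), f j :=
    Finset.sum_equiv σ (by simp) (by simp)
  have hIio : (Finset.univ.filter fun j => id j < id i) = Finset.Iio i := by ext; simp
  rw [displacement, offset, offset, hIio, Finset.sum_sub_distrib, Finset.sum_sub_distrib, himage,
    Finset.sum_map]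
  simp only [Equiv.coe_toEmbedding]
  abel

variable [LinearOrder M] [IsOrderedAddMonoid M] {f : ι → M}

theorem sum_Iio_lt_sum (hf : StrictMono f) {s : Finset ι}
    (hcard : s.card = (Finset.Iio i).card) (hs : s ≠ Finset.Iio i) :
    ∑ j ∈ Finset.Iio i, f j < ∑ j ∈ s, f j := by
  have hne : (Finset.Iio i \ s).Nonempty := by
    rw [Finset.sdiff_nonempty]
    exact fun h => hs (Finset.eq_of_subset_of_card_le h hcard.le).symm
  rw [← Finset.sum_sdiff_lt_sum_sdiff]
  calc ∑ j ∈ Finset.Iio i \ s, f j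
      < ∑ _j ∈ Finset.Iio i \ s, f i := Finset.sum_lt_sum_of_nonempty hne fun j hj =>
        hf (Finset.mem_Iio.1 (Finset.mem_sdiff.1 hj).1)
    _ = (s \ Finset.Iio i).card • f i := by rw [Finset.sum_const, Finset.card_sdiff_comm hcard]
    _ ≤ ∑ j ∈ s \ Finset.Iio i, f j := Finset.card_nsmul_le_sum _ _ _ fun j hj =>
        hf.monotone (not_lt.1 fun h => (Finset.mem_sdiff.1 hj).2 (Finset.mem_Iio.2 h))

theorem sum_Iio_le_sum (hf : StrictMono f) {s : Finset ι}
    (hcard : s.card = (Finset.Iio i).card) : ∑ j ∈ Finset.Iio i, f j ≤ ∑ j ∈ s, f j := by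
  rcases eq_or_ne s (Finset.Iio i) with rfl | hs
  exacts [le_rfl, (sum_Iio_lt_sum hf hcard hs).le]

/-- Both parts of `displacement_id_perm_eq` compare an initial segment with a set of the same
cardinality, and admissibility excludes that both comparisons are equalities. -/
theorem displacement_id_perm_pos [Fintype ι] (hf : StrictMono f) {σ : Equiv.Perm ι}
    (hσ : ¬ ∃ k, σ k = k ∧ σ '' Set.Iic k = Set.Iic k) (i : ι) :
    0 < displacement id σ (fun j => f j - f (σ j)) i := by
  have hcard : ((Finset.Iio i).map σ.toEmbedding).card = (Finset.Iio i).card := Finset.card_map _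
  have hcard' : (Finset.univ.filter fun j => σ j < σ i).card = (Finset.Iio (σ i)).card :=
    Finset.card_equiv σ (by simp)
  rw [displacement_id_perm_eq]
  by_cases h : (Finset.Iio i).map σ.toEmbedding = Finset.Iio i
  · refine add_pos_of_pos_of_nonneg (sub_pos.2 (sum_Iio_lt_sum hf hcard' fun h' => hσ ⟨i, ?_⟩))
      (sub_nonneg.2 (sum_Iio_le_sum hf hcard))
    apply apply_eq_self_and_image_Iic_eq
    · simpa using congrArg ((↑) : Finset ι → Set ι) h
    · ext j
      simpa using Finset.ext_iff.1 h' j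
  · exact add_pos_of_nonneg_of_pos (sub_nonneg.2 (sum_Iio_le_sum hf hcard'))
      (sub_pos.2 (sum_Iio_lt_sum hf hcard h))

end Admissible

section DriftDirection

variable {n : ℕ} {σ : Equiv.Perm (Fin n)}

/-- The direction of lengths in which the perturbation moves: lengthening the `j`-th interval
proportionally to `j - σ j` makes every interval of an admissible exchange drift to the right. -/
def driftDirection (σ : Equiv.Perm (Fin n)) (j : Fin n) : ℝ := (j : ℕ) - (σ j : ℕ)

theorem sum_driftDirection (σ : Equiv.Perm (Fin n)) : ∑ j, driftDirection σ j = 0 := by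
  simp only [driftDirection, Finset.sum_sub_distrib]
  rw [Equiv.sum_comp σ fun j => ((j : ℕ) : ℝ), sub_self]

theorem one_le_displacement_driftDirection (hσ : ¬ ∃ k, σ k = k ∧ σ '' Set.Iic k = Set.Iic k)
    (i : Fin n) : 1 ≤ displacement id σ (driftDirection σ) i := by
  have hpos : (0 : ℤ) < displacement id σ (fun j => ((j : ℕ) : ℤ) - (σ j : ℕ)) i :=
    displacement_id_perm_pos (f := fun j : Fin n => ((j : ℕ) : ℤ))
      (fun _ _ h => Nat.cast_lt.2 h) hσ i
  have hcast : displacement id σ (driftDirection σ) i =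
      (displacement id σ (fun j => ((j : ℕ) : ℤ) - (σ j : ℕ)) i : ℤ) := by
    simp [displacement, offset, driftDirection]
  rw [hcast]
  exact_mod_cast hpos

end DriftDirection

section Approximation

open Filter Topology

theorem eventually_mul_lt (A : ℝ) {B : ℝ} (hB : 0 < B) : ∀ᶠ t in 𝓝[>] 0, A * t < B := by
  have h : Tendsto (fun t => A * t) (𝓝[>] 0) (𝓝 (A * 0)) :=
    (continuous_const_mul A).continuousWithinAt
  exact h.eventually_lt_const (by rwa [mul_zero])

theorem exists_intCast_mul_inv_mem {ι : Type*} [Fintype ι] {l : ι → ℝ} (hl : ∀ i, 0 ≤ l i)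
    (hsum : ∑ i, l i = 1) {U : Set (ι → ℝ)} (hU : U ∈ 𝓝 l) :
    ∃ (q : ℕ) (a : ι → ℤ), q ≠ 0 ∧ ∑ i, a i = q ∧ (fun i => a i * (q : ℝ)⁻¹) ∈ U := by
  have hfloor : ∀ i, Tendsto (fun x : ℝ => (⌊l i * x⌋₊ : ℝ) / x) atTop (𝓝 (l i)) := fun i =>
    tendsto_nat_floor_mul_div_atTop (hl i)
  have htotal : Tendsto (fun x : ℝ => (∑ i, ⌊l i * x⌋₊ : ℕ) / x) atTop (𝓝 1) := by
    simpa only [Nat.cast_sum, Finset.sum_div, hsum] using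
      tendsto_finsetSum Finset.univ fun i _ => hfloor i
  have hratio : Tendsto (fun (x : ℝ) i => (⌊l i * x⌋₊ : ℝ) * ((∑ j, ⌊l j * x⌋₊ : ℕ) : ℝ)⁻¹) atTop
      (𝓝 l) := by
    refine tendsto_pi_nhds.2 fun i => ?_
    have hdiv := (hfloor i).div htotal one_ne_zero
    rw [div_one] at hdiv
    refine hdiv.congr' ?_
    filter_upwards [eventually_ne_atTop 0] with x hx
    rw [Pi.div_apply, div_div_div_cancel_right₀ hx, div_eq_mul_inv]
  obtain ⟨x, hxU, hx⟩ :=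
    ((hratio.eventually_mem hU).and (htotal.eventually_const_lt one_pos)).exists
  refine ⟨∑ i, ⌊l i * x⌋₊, fun i => ⌊l i * x⌋₊, fun h => ?_, by push_cast; rfl, by simpa using hxU⟩
  simp [h] at hx

end Approximation

namespace IET

open Filter Topology

theorem rearranges (T : IET) : Rearranges T.toPerm id T.perm T.len :=
  fun i x hx => T.toPerm_apply i x hx.1 hx.2

/-- The right endpoints of the intervals of continuity of `S` and the opposites of its translation
lengths, together with `0`. -/
noncomputable def singularities (S : IET) : Finset ℝ :=
  insert 0 (Finset.univ.image (fun i => offset id S.len i + S.len i) ∪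
    Finset.univ.image fun i => -displacement id S.perm S.len i)

theorem isPiecewiseTranslation (S : IET) : IsPiecewiseTranslation S.toPerm S.singularities := by
  intro z
  obtain ⟨i, hi⟩ := exists_mem_slot Function.injective_id S.len_sum z.2
  have hlen : -displacement id S.perm S.len i ∈ S.singularities := by simp [singularities]
  have hend : offset id S.len i + S.len i ∈ S.singularities := by simp [singularities]
  exact ⟨_, _, hlen, hend, hi.2, (S.rearranges i).mono (Set.Ico_subset_Ico_left hi.1)⟩

theorem exists_rearranges_of_edist_lt {S T : IET} {ε : ℝ} (h : edist S T < ENNReal.ofReal ε) :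
    ∃ l : Fin S.n → ℝ, ∑ i, l i = 1 ∧ Rearranges T.toPerm id S.perm l ∧
      ∑ i, |S.len i - l i| < ε := by
  by_cases hST : SamePerm S T
  · rw [edist_def S T hST, ENNReal.ofReal_lt_ofReal_iff_of_nonneg (by positivity)] at h
    have hT := T.rearranges
    obtain ⟨_, n, σ, l, _, _, _, _⟩ := S
    obtain ⟨_, m, τ, l', _, hl', _, _⟩ := T
    obtain ⟨hn, hστ⟩ := hST
    dsimp only at hn hστ h hT ⊢
    subst hn
    obtain rfl : σ = τ := Equiv.ext hστ
    exact ⟨l', hl', hT, h⟩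
  · rw [edist_eq_top S T hST] at h
    exact absurd h not_top_lt

theorem exists_rearranges_perm (T : IET) {l : Fin T.n → ℝ} (hl : ∀ i, 0 < l i)
    (hsum : ∑ i, l i = 1) :
    ∃ f : Equiv.Perm (Set.Ico (0 : ℝ) 1), Rearranges f id T.perm l :=
  exists_perm_rearranges Function.injective_id T.perm.injective (fun i => (hl i).le) hsum

/-- The IET with the same underlying permutation as `T` and with lengths `l`. -/
noncomputable def withLengths (T : IET) (l : Fin T.n → ℝ) (hl : ∀ i, 0 < l i)
    (hsum : ∑ i, l i = 1) : IET where
  toPerm := (T.exists_rearranges_perm hl hsum).choose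
  n := T.n
  perm := T.perm
  len := l
  len_pos := hl
  len_sum := hsum
  reduced := T.reduced
  toPerm_apply i x hx hx' := (T.exists_rearranges_perm hl hsum).choose_spec i x ⟨hx, hx'⟩

theorem edist_withLengths (T : IET) {l : Fin T.n → ℝ} (hl : ∀ i, 0 < l i)
    (hsum : ∑ i, l i = 1) :
    edist T (T.withLengths l hl hsum) = ENNReal.ofReal (∑ i, |T.len i - l i|) :=
  edist_def T (T.withLengths l hl hsum) ⟨rfl, fun _ => rfl⟩

theorem eventually_forall_not_nonempty_mulEquiv_freeGroup (S : IET) {n : ℕ}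
    {σ : Equiv.Perm (Fin n)} (hσ : ¬ ∃ k, σ k = k ∧ σ '' Set.Iic k = Set.Iic k) {κ : ℝ} {q : ℕ}
    (hq : q * κ = 1) :
    ∀ᶠ t in 𝓝[>] 0, ∀ (a : Fin n → ℤ) (l : Fin n → ℝ) (f : Equiv.Perm (Set.Ico (0 : ℝ) 1)),
      ∑ i, l i = 1 → Rearranges f id σ l →
        ∑ j, |l j - (a j * κ + t * driftDirection σ j)| < t / 4 →
          ¬ Nonempty (Subgroup.closure {S.toPerm, f} ≃* FreeGroup (Fin 2)) := by
  have hκ := pos_of_natCast_mul_eq_one hq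
  obtain ⟨γ, hγ0, hγ⟩ := exists_hasGap hκ S.singularities
  obtain ⟨C, hC⟩ : ∃ C, 2 * ∑ j, |driftDirection σ j| + 1 = C := ⟨_, rfl⟩
  have hC0 : 0 < C := hC ▸ by positivity
  obtain ⟨k, hk⟩ := exists_nat_ge (12 * ((q.factorial + 1) * C))
  have hk0 : k ≠ 0 := (Nat.cast_pos.1 (lt_of_lt_of_le (by positivity) hk)).ne'
  filter_upwards [eventually_mul_lt (4 * C) hκ,
    eventually_mul_lt (k * C + 6 * ((q.factorial + 1) * C)) hγ0, self_mem_nhdsWithin]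
    with t htκ htγ ht a l f hsum hf hlen
  rw [Set.mem_Ioi] at ht
  have hdrift := hf.driftsMod_of_perturbation Function.injective_id hsum ht.le
    (one_le_displacement_driftDirection hσ) hlen
  have hcells := hf.translatesCells_of_perturbation Function.injective_id hsum hκ ht.le hlen
  rw [hC] at hdrift hcells
  have hkt := mul_le_mul_of_nonneg_right hk ht.le
  exact not_nonempty_mulEquiv_freeGroup_of_commute q.factorial_ne_zero hk0
    (hdrift.commute_nestedCommutator hq (by positivity) (by positivity) (by linarith) hcells
      S.isPiecewiseTranslation (Finset.mem_insert_self _ _) hγ (by linarith) (by linarith))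

theorem eventually_len_pos_and_sum_abs_sub_lt (T : IET) {ε : ENNReal} (hε : 0 < ε) :
    ∀ᶠ l in 𝓝 T.len, (∀ i, 0 < l i) ∧ ENNReal.ofReal (∑ i, |T.len i - l i|) < ε := by
  have hpos : ∀ᶠ l in 𝓝 T.len, ∀ i, 0 < l i := eventually_all.2 fun i =>
    (continuous_apply i).continuousAt.eventually_const_lt (T.len_pos i)
  have hdist : Continuous fun l : Fin T.n → ℝ => ENNReal.ofReal (∑ i, |T.len i - l i|) :=
    ENNReal.continuous_ofReal.comp (by fun_prop)
  exact hpos.and (hdist.continuousAt.eventually_lt_const (by simpa using hε))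

theorem exists_edist_lt_forall_not_nonempty_mulEquiv_freeGroup (S : IET) {T : IET}
    (hT : T.IsAdmissible) {ε : ENNReal} (hε : 0 < ε) :
    ∃ T' : IET, T'.IsAdmissible ∧ edist T T' < ε ∧ ∃ δ > 0, ∀ T'' : IET, edist T' T'' < δ →
      ¬ Nonempty (Subgroup.closure {S.toPerm, T''.toPerm} ≃* FreeGroup (Fin 2)) := by
  obtain ⟨q, a, hq0, ha, haU⟩ := exists_intCast_mul_inv_mem (fun i => (T.len_pos i).le) T.len_sum
    (T.eventually_len_pos_and_sum_abs_sub_lt hε).eventually_nhds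
  have hq : q * (q : ℝ)⁻¹ = 1 := mul_inv_cancel₀ (Nat.cast_ne_zero.2 hq0)
  let l (t : ℝ) (j : Fin T.n) : ℝ := a j * (q : ℝ)⁻¹ + t * driftDirection T.perm j
  have hl : Tendsto l (𝓝[>] 0) (𝓝 fun j => a j * (q : ℝ)⁻¹) := by
    have hcont : Continuous l := by fun_prop
    simpa [l] using hcont.continuousWithinAt.tendsto (x := 0) (s := Set.Ioi 0)
  obtain ⟨t, ⟨⟨hpos, hdist⟩, hfree⟩, ht⟩ := ((hl.eventually haU).and
    (S.eventually_forall_not_nonempty_mulEquiv_freeGroup hT hq)).and self_mem_nhdsWithin |>.exists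
  have hsum : ∑ j, l t j = 1 := by
    rw [Finset.sum_add_distrib, ← Finset.sum_mul, ← Finset.mul_sum, sum_driftDirection,
      ← Int.cast_sum, ha, Int.cast_natCast, hq, mul_zero, add_zero]
  refine ⟨T.withLengths (l t) hpos hsum, hT, (T.edist_withLengths hpos hsum).trans_lt hdist,
    ENNReal.ofReal (t / 4), by simpa using ht, fun T'' hT'' => ?_⟩
  obtain ⟨l'', hsum'', hT'', hlt⟩ := exists_rearranges_of_edist_lt hT''
  simp_rw [abs_sub_comm _ (l'' _)] at hlt
  exact hfree a l'' T''.toPerm hsum'' hT'' hlt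

end IET

theorem theorem1 (S : IET) :
    ∃ Ω : Set AdmissibleIET, IsOpen Ω ∧ Dense Ω ∧
      ∀ T ∈ Ω, ¬ Nonempty (Subgroup.closure {S.toPerm, T.1.toPerm} ≃* FreeGroup (Fin 2)) := by
  refine ⟨interior {T | ¬ Nonempty
    (Subgroup.closure {S.toPerm, T.1.toPerm} ≃* FreeGroup (Fin 2))}, isOpen_interior, fun T => ?_,
    fun T hT => interior_subset hT⟩
  rw [EMetric.mem_closure_iff]
  intro ε hε
  obtain ⟨T', hT', hTT', δ, hδ, hfree⟩ :=
    S.exists_edist_lt_forall_not_nonempty_mulEquiv_freeGroup T.2 hε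
  refine ⟨⟨T', hT'⟩, ?_, hTT'⟩
  rw [mem_interior_iff_mem_nhds, EMetric.mem_nhds_iff]
  exact ⟨δ, hδ, fun T'' hT'' => hfree T''.1 (by rwa [edist_comm])⟩
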